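/- Let $v=(v_1,v_2,v_3)\in\mathbb{Z}^3$ satisfy $v_1+v_2+v_3=0$, $v_1v_2v_3\neq 0$ and $\gcd(v_1,v_2,v_3)=1$. For a polynomial $P\in\mathbb{Q}[x_1,x_2,x_3]$ write $P_v(z)=P(z^{v_1},z^{v_2},z^{v_3})\in\mathbb{Q}[z^{\pm}]$, where $\mathbb{Q}[z^{\pm}]$ is the ring of Laurent polynomials. Then there are finitely many roots of unity $\zeta_1,\ldots,\zeta_r\in\mathbb{C}\setminus\{1\}$ and natural numbers $a_1,\ldots,a_r$ (depending only on $v$) such that every Laurent polynomial $F\in\mathbb{Q}[z^{\pm}]$ with $F'(1)=0$ which vanishes at $\zeta_i$ with multiplicity at least $a_i$ for all $i=1,\ldots,r$ (that is, $(z-\zeta_i)^{a_i}$ divides $F$ in $\mathbb{C}[z^{\pm}]$) can be expressed as $F=P_v(z)$ for some symmetric polynomial $P\in\mathbb{Q}[x_1,x_2,x_3]$. -/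

import Mathlib

namespace LaurentSubst

open scoped LaurentPolynomial

/-- The formal derivative of a Laurent polynomial: `∑ cₙ zⁿ ↦ ∑ n cₙ zⁿ⁻¹`. -/
noncomputable def derivative {R : Type*} [CommRing R] (F : R[T;T⁻¹]) : R[T;T⁻¹] :=
  F.coeff.sum fun n c => LaurentPolynomial.C ((n : R) * c) * LaurentPolynomial.T (n - 1)

/-- The value of a Laurent polynomial at a unit `x` of the coefficient ring. -/
noncomputable def evalAt {R : Type*} [CommRing R] (x : Rˣ) (F : R[T;T⁻¹]) : R :=
  LaurentPolynomial.eval₂ (RingHom.id R) x F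

/-- `F ∈ ℚ[z^±]` vanishes at the (nonzero) complex number `ζ` with multiplicity at least `a`:
`(z - ζ) ^ a` divides `F` in `ℂ[z^±]`. -/
def VanishesToOrder (F : ℚ[T;T⁻¹]) (ζ : ℂ) (a : ℕ) : Prop :=
  (LaurentPolynomial.T 1 - LaurentPolynomial.C ζ : ℂ[T;T⁻¹]) ^ a ∣
    AddMonoidAlgebra.mapRingHom ℤ (algebraMap ℚ ℂ) F

/-- The substitution `P_v(z) = P(z ^ v₁, z ^ v₂, z ^ v₃)`. -/
noncomputable def subst (v : Fin 3 → ℤ) (P : MvPolynomial (Fin 3) ℚ) : ℚ[T;T⁻¹] :=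
  MvPolynomial.aeval (fun i => (LaurentPolynomial.T (v i) : ℚ[T;T⁻¹])) P

end LaurentSubst

/-!
Write `B = K[z, z⁻¹]` and let `A ⊆ B` be the subalgebra generated by `e₁ = ∑ z ^ v i` and
`e₂ = ∑ z ^ (-v i)`, which are the first two elementary symmetric functions of the `z ^ v i`; the
third one is `1`. Every element of `A` is the substitution of a symmetric polynomial, so the task
is to show that a Laurent polynomial vanishing to high order at suitable roots of unity other
than `1`, and with derivative zero at `1`, lies in `A`.

Over `K = ℂ`, consider the curve `z ↦ (e₁(z), e₂(z))` on `ℂˣ`. The ring `B` is finite over `A`,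
since the `z ^ v i` are the roots of `t³ - e₁ t² + e₂ t - 1`.

* At a point `x` that is not a root of unity the curve is injective (`eq_of_ev_eq`) and immersed
  (`ev_derivative_ne_zero`), so `z - x` lies in the ideal of `B` generated by `e₁ - e₁(x)` and
  `e₂ - e₂(x)`. By Nakayama's lemma some `s ∈ A` with `s(x) = 1` multiplies `B` into `A`
  (`exists_mul_mem_of_not_isOfFinOrder`).
* The point `1` is alone in its fibre, and there the curve has an ordinary cusp:
  `e₁ + e₂ - 6 = ∑ (z ^ v i - 1)² / z ^ v i` has a zero of order exactly two, and
  `e₂ - e₁ = ∏ (1 - z ^ v i)` has a zero of order exactly three. By Nakayama's lemma again, some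
  `s₁ ∈ A` with `s₁(1) = 1` multiplies all `F` with `F'(1) = 0` into `A` (`exists_mul_mem_one`).

Hence the elements of `A` that multiply `{F | F'(1) = 0}` into `A` have only finitely many common
zeros, all of them roots of unity other than `1`. They generate an ideal `(D)` of `B`. If `F` is
divisible by `D` and `F'(1) = 0`, then `F - F(1) s₁` is divisible by `(z - 1)² D`, and such
multiples lie in `A` (`exists_forall_dvd_imp_mem`).

Finally, a rational Laurent polynomial in the complex version of `A` lies in the rational one, by
applying a `ℚ`-linear retraction `ℂ → ℚ` to coefficients (`mem_symmSubalgebra_of_mapRingHom_mem`).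
-/

namespace LaurentSubst

open LaurentPolynomial

/-! ### Formal derivatives and evaluation -/

section Derivative

variable {R : Type*} [CommRing R]

theorem derivative_add (F G : R[T;T⁻¹]) :
    derivative (F + G) = derivative F + derivative G := by
  unfold derivative
  rw [AddMonoidAlgebra.coeff_add]
  exact Finsupp.sum_add_index' (by simp) (by intros; simp [mul_add, add_mul])

theorem derivative_C_mul_T (c : R) (n : ℤ) :
    derivative (C c * T n) = C ((n : R) * c) * T (n - 1) := by
  unfold derivative
  rw [← single_eq_C_mul_T, AddMonoidAlgebra.coeff_single, Finsupp.sum_single_index (by simp)]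

theorem derivative_C (c : R) : derivative (C c) = 0 := by
  simpa using derivative_C_mul_T c 0

theorem derivative_T (n : ℤ) : derivative (T n : R[T;T⁻¹]) = C (n : R) * T (n - 1) := by
  simpa using derivative_C_mul_T (1 : R) n

theorem derivative_mul (F G : R[T;T⁻¹]) :
    derivative (F * G) = derivative F * G + F * derivative G := by
  induction F using LaurentPolynomial.induction_on' with
  | add p q hp hq => rw [add_mul, derivative_add, hp, hq, derivative_add]; ring
  | C_mul_T n a =>
    induction G using LaurentPolynomial.induction_on' with
    | add p q hp hq => rw [mul_add, derivative_add, hp, hq, derivative_add]; ring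
    | C_mul_T m b =>
      have e : (C a * T n * (C b * T m) : R[T;T⁻¹]) = C (a * b) * T (n + m) := by
        rw [map_mul, T_add]; ring
      rw [e]
      simp only [derivative_C_mul_T]
      rw [show n + m - 1 = (n - 1) + m by ring, T_add,
        show (C a * T n * (C (↑m * b) * T (m - 1)) : R[T;T⁻¹])
          = C a * C (↑m * b) * T (n - 1 + m) by
          rw [show n - 1 + m = n + (m - 1) by ring, T_add]; ring, T_add]
      simp only [Int.cast_add, map_mul, map_add]
      ring

/-- The derivative as a linear map. -/
noncomputable def derivativeₗ : R[T;T⁻¹] →ₗ[R] R[T;T⁻¹] where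
  toFun := derivative
  map_add' := derivative_add
  map_smul' c F := by
    rw [smul_eq_C_mul, derivative_mul, derivative_C, RingHom.id_apply, smul_eq_C_mul]; ring

theorem derivative_sub (F G : R[T;T⁻¹]) :
    derivative (F - G) = derivative F - derivative G :=
  map_sub (derivativeₗ (R := R)) F G

/-- Evaluation at a unit, as a ring homomorphism. -/
noncomputable abbrev ev (x : Rˣ) : R[T;T⁻¹] →+* R := eval₂ (RingHom.id R) x

end Derivative

/-! ### Zeros and ideals of Laurent polynomials over a field -/

section Field

variable {K : Type*} [Field K]

theorem ev_eq_zero_iff_dvd (x : Kˣ) (F : K[T;T⁻¹]) : ev x F = 0 ↔ T 1 - C (x : K) ∣ F := by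
  constructor
  · intro h
    obtain ⟨n, p, hp⟩ := exists_T_pow F
    have hr : p.IsRoot (x : K) := by
      have := congrArg (ev x) hp
      rw [map_mul, h, zero_mul, ev, eval₂_toLaurent] at this
      simpa [Polynomial.IsRoot, Polynomial.eval₂_id] using this
    obtain ⟨q, rfl⟩ := Polynomial.dvd_iff_isRoot.mpr hr
    have h2 := (isUnit_T (R := K) n).dvd_mul_right (a := T 1 - C (x : K)) (b := F)
    rw [← h2, ← hp, map_mul]
    simp [Polynomial.toLaurent_X, Polynomial.toLaurent_C]
  · rintro ⟨G, rfl⟩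
    simp

theorem ev_derivative_of_sq_dvd (x : Kˣ) {F : K[T;T⁻¹]} (h : (T 1 - C (x : K)) ^ 2 ∣ F) :
    ev x (derivative F) = 0 := by
  obtain ⟨G, rfl⟩ := h
  rw [sq, mul_assoc, derivative_mul, derivative_mul]
  simp

/-- A Laurent polynomial vanishing at `x` together with its derivative has a double zero. -/
theorem sq_dvd_of_ev_derivative (x : Kˣ) {F : K[T;T⁻¹]} (h : ev x F = 0)
    (h' : ev x (derivative F) = 0) : (T 1 - C (x : K)) ^ 2 ∣ F := by
  obtain ⟨G, rfl⟩ := (ev_eq_zero_iff_dvd x F).mp h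
  rw [derivative_mul, derivative_sub, derivative_C, derivative_T] at h'
  have hG : ev x G = 0 := by simpa using h'
  rw [sq]
  exact mul_dvd_mul_left _ ((ev_eq_zero_iff_dvd x G).mp hG)

theorem T_one_sub_C_ne_zero (w : K) : (T 1 - C w : K[T;T⁻¹]) ≠ 0 := by
  have : (T 1 - C w : K[T;T⁻¹]) = Polynomial.toLaurent (Polynomial.X - Polynomial.C w) := by
    simp [Polynomial.toLaurent_X, Polynomial.toLaurent_C]
  rw [this, Polynomial.toLaurent_ne_zero]
  exact Polynomial.X_sub_C_ne_zero w

theorem isCoprime_T_one_sub_C {w w' : K} (h : w ≠ w') :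
    IsCoprime (T 1 - C w : K[T;T⁻¹]) (T 1 - C w') := by
  simpa [Polynomial.toLaurent_X, Polynomial.toLaurent_C] using
    (Polynomial.isCoprime_X_sub_C_of_isUnit_sub (sub_ne_zero.mpr h).isUnit).map
      (Polynomial.toLaurent (R := K))

/-- Over an algebraically closed field, a nonzero ideal of Laurent polynomials is generated by a
product of powers of `z - w`, where `w` runs through the common zeros of the ideal. -/
theorem exists_eq_span_prod [IsAlgClosed K] {J : Ideal K[T;T⁻¹]} (hJ : J ≠ ⊥) :
    ∃ (S : Finset Kˣ) (a : Kˣ → ℕ), (∀ w ∈ S, 0 < a w) ∧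
      J = Ideal.span {∏ w ∈ S, (T 1 - C (w : K)) ^ a w} := by
  classical
  let p := Submodule.IsPrincipal.generator (J.comap (Polynomial.toLaurent (R := K)))
  have hp : J.comap (Polynomial.toLaurent (R := K)) = Ideal.span {p} :=
    (Ideal.span_singleton_generator _).symm
  -- `J` is generated by the image of `p`, as powers of `z` are units
  have hJp : J = Ideal.span {Polynomial.toLaurent p} := by
    apply le_antisymm
    · intro F hF
      obtain ⟨n, q, hq⟩ := exists_T_pow F
      have hqJ : q ∈ Ideal.span {p} := by
        rw [← hp, Ideal.mem_comap, hq]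
        exact J.mul_mem_right _ hF
      rw [Ideal.mem_span_singleton] at hqJ ⊢
      rw [← (isUnit_T (R := K) n).dvd_mul_right, ← hq]
      exact map_dvd _ hqJ
    · rw [Ideal.span_singleton_le_iff_mem, ← Ideal.mem_comap, hp]
      exact Ideal.mem_span_singleton_self p
  have hp0 : p ≠ 0 := by
    intro h
    rw [h, map_zero, Ideal.span_singleton_eq_bot.mpr rfl] at hJp
    exact hJ hJp
  let S : Finset Kˣ := (p.roots.toFinset.erase 0).attach.image
    fun w : {w // w ∈ p.roots.toFinset.erase 0} => Units.mk0 w.1 (Finset.ne_of_mem_erase w.2)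
  have hS : ∀ w : Kˣ, w ∈ S ↔ (w : K) ∈ p.roots := by
    intro w
    simp only [S, Finset.mem_image, Finset.mem_attach, true_and, Subtype.exists]
    constructor
    · rintro ⟨b, hb, rfl⟩
      exact Multiset.mem_toFinset.mp (Finset.mem_of_mem_erase hb)
    · intro h
      exact ⟨w, Finset.mem_erase.mpr ⟨w.ne_zero, Multiset.mem_toFinset.mpr h⟩, Units.ext rfl⟩
  refine ⟨S, fun w => p.roots.count (w : K), fun w hw => Multiset.count_pos.mpr ((hS w).mp hw), ?_⟩
  rw [hJp, Ideal.span_singleton_eq_span_singleton]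
  have hprod : p = Polynomial.C p.leadingCoeff *
      ∏ w ∈ p.roots.toFinset, (Polynomial.X - Polynomial.C w) ^ p.roots.count w := by
    rw [← Finset.prod_multiset_map_count]
    exact (IsAlgClosed.splits p).eq_prod_roots
  have hSprod : ∏ w ∈ S, (T 1 - C (w : K) : K[T;T⁻¹]) ^ p.roots.count (w : K)
      = ∏ w ∈ p.roots.toFinset.erase 0, (T 1 - C w : K[T;T⁻¹]) ^ p.roots.count w := by
    refine Finset.prod_bij (fun w _ => (w : K)) ?_ ?_ ?_ ?_
    · intro w hw
      exact Finset.mem_erase.mpr ⟨w.ne_zero, Multiset.mem_toFinset.mpr ((hS w).mp hw)⟩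
    · intro w _ w' _ h
      exact Units.ext h
    · intro b hb
      exact ⟨Units.mk0 b (Finset.ne_of_mem_erase hb),
        (hS _).mpr (Multiset.mem_toFinset.mp (Finset.mem_of_mem_erase hb)), rfl⟩
    · intros; rfl
  have hfac : ∀ w : K, Polynomial.toLaurent (Polynomial.X - Polynomial.C w) = T 1 - C w := by
    intro w
    simp [Polynomial.toLaurent_X, Polynomial.toLaurent_C]
  have hlead : IsUnit (C p.leadingCoeff : K[T;T⁻¹]) :=
    (Polynomial.leadingCoeff_ne_zero.mpr hp0).isUnit.map C
  have himg : Polynomial.toLaurent p = C p.leadingCoeff *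
      ∏ w ∈ p.roots.toFinset, (T 1 - C w : K[T;T⁻¹]) ^ p.roots.count w := by
    conv_lhs => rw [hprod]
    simp only [map_mul, map_prod, map_pow, hfac, Polynomial.toLaurent_C]
  have hassoc : Associated (∏ w ∈ p.roots.toFinset, (T 1 - C w : K[T;T⁻¹]) ^ p.roots.count w)
      (∏ w ∈ p.roots.toFinset.erase 0, (T 1 - C w : K[T;T⁻¹]) ^ p.roots.count w) := by
    by_cases h0 : (0 : K) ∈ p.roots.toFinset
    · rw [← Finset.mul_prod_erase _ _ h0, map_zero, sub_zero]
      exact associated_unit_mul_left _ _ ((isUnit_T 1).pow _)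
    · rw [Finset.erase_eq_of_notMem h0]
  rw [hSprod, himg]
  exact (associated_unit_mul_left _ _ hlead).trans hassoc

/-- If `x` is the only common zero of an ideal of Laurent polynomials, and some member of it does
not vanish to order `k + 1` at `x`, then the ideal contains `(z - x) ^ k`. -/
theorem pow_mem_of_unique_zero [IsAlgClosed K] {J : Ideal K[T;T⁻¹]} (x : Kˣ)
    (hx : ∀ w : Kˣ, (∀ F ∈ J, ev w F = 0) → w = x) {k : ℕ} {h : K[T;T⁻¹]} (hJ : h ∈ J)
    (hk : ¬ (T 1 - C (x : K)) ^ (k + 1) ∣ h) : (T 1 - C (x : K)) ^ k ∈ J := by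
  have hne : J ≠ ⊥ := by
    rintro rfl
    rw [Ideal.mem_bot] at hJ
    exact hk (hJ ▸ dvd_zero _)
  obtain ⟨S, a, ha, rfl⟩ := exists_eq_span_prod hne
  have hS : ∀ w ∈ S, w = x := by
    intro w hw
    refine hx w fun F hF => ?_
    rw [ev_eq_zero_iff_dvd]
    have h1 : (T 1 - C (w : K) : K[T;T⁻¹]) ∣ (T 1 - C (w : K)) ^ a w :=
      dvd_pow_self _ (ha w hw).ne'
    have h2 := Finset.dvd_prod_of_mem (fun w : Kˣ => (T 1 - C (w : K) : K[T;T⁻¹]) ^ a w) hw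
    exact (h1.trans h2).trans (Ideal.mem_span_singleton.mp hF)
  rw [Ideal.mem_span_singleton] at hJ ⊢
  have hS' : S ⊆ {x} := fun w hw => Finset.mem_singleton.mpr (hS w hw)
  rcases Finset.subset_singleton_iff.mp hS' with rfl | rfl
  · simp
  · rw [Finset.prod_singleton] at hJ ⊢
    refine pow_dvd_pow _ ?_
    by_contra! hlt
    exact hk ((pow_dvd_pow _ hlt).trans hJ)

end Field

/-! ### Nakayama's lemma -/

/-- A form of Nakayama's lemma: if `N ⊆ P + I N`, then some element of `1 + I` multiplies `N`
into `P`. -/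
theorem exists_smul_mem_of_le_sup_smul {R M : Type*} [CommRing R] [AddCommGroup M] [Module R M]
    (I : Ideal R) (N P : Submodule R M) (hN : N.FG) (h : N ≤ P ⊔ I • N) :
    ∃ s : R, s - 1 ∈ I ∧ ∀ n ∈ N, s • n ∈ P := by
  have h2 : N.map P.mkQ ≤ I • N.map P.mkQ := by
    have := Submodule.map_mono (f := P.mkQ) h
    rwa [Submodule.map_sup, Submodule.map_smul'', Submodule.mkQ_map_self, bot_sup_eq] at this
  obtain ⟨s, hs, hs'⟩ :=
    Submodule.exists_sub_one_mem_and_smul_eq_zero_of_fg_of_le_smul I _ (hN.map P.mkQ) h2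
  refine ⟨s, hs, fun n hn => ?_⟩
  have := hs' _ (Submodule.mem_map_of_mem hn)
  rwa [← map_smul, Submodule.mkQ_apply, Submodule.Quotient.mk_eq_zero] at this

/-! ### Integer exponents with sum zero -/

section Exponents

variable {v : Fin 3 → ℤ}

/-- A self-map of the indices under which the exponents become proportional to themselves fixes
the exponents: the ratio is `±1` by comparing largest and smallest absolute values, and
it is not `-1`, as two opposite exponents would force the third one to vanish. -/
theorem comp_eq_of_mul_comm (hsum : v 0 + v 1 + v 2 = 0) (hprod : v 0 * v 1 * v 2 ≠ 0)
    (σ : Fin 3 → Fin 3) (h : ∀ i j, v (σ i) * v j = v (σ j) * v i) (i : Fin 3) :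
    v (σ i) = v i := by
  have hne : ∀ i, v i ≠ 0 := by
    intro i hi
    fin_cases i <;> simp_all
  obtain ⟨a, -, ha⟩ := Finset.exists_max_image Finset.univ (fun i => |v i|) ⟨0, Finset.mem_univ _⟩
  obtain ⟨b, -, hb⟩ := Finset.exists_min_image Finset.univ (fun i => |v i|) ⟨0, Finset.mem_univ _⟩
  have h1 := ha (σ a) (Finset.mem_univ _)
  have h2 := hb (σ b) (Finset.mem_univ _)
  have h3 : |v (σ a)| * |v b| = |v (σ b)| * |v a| := by
    rw [← abs_mul, ← abs_mul, h a b]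
  have hapos := abs_pos.mpr (hne a)
  have hbpos := abs_pos.mpr (hne b)
  have hab : |v (σ a)| = |v a| := by
    refine le_antisymm h1 ?_
    by_contra! hlt
    nlinarith
  rcases abs_eq_abs.mp hab with hab | hab
  · have := h a i
    rw [hab] at this
    exact mul_left_cancel₀ (hne a) (by linarith)
  · exfalso
    have hneg : ∀ i, v (σ i) = -v i := by
      intro i
      have := h a i
      rw [hab] at this
      exact mul_left_cancel₀ (hne a) (by linarith)
    have hk : ∀ i j : Fin 3, v j = -v i → i = j := by
      intro i j hij
      have := hne 0; have := hne 1; have := hne 2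
      fin_cases i <;> fin_cases j <;> first | rfl | (simp at hij; omega)
    have := hk 0 (σ 0) (hneg 0)
    have h4 := hneg 0
    rw [← this] at h4
    exact hne 0 (by omega)

theorem eq_of_forall_zpow_eq {G : Type*} [CommGroup G] (hgcd : Finset.univ.gcd v = 1) {x w : G}
    (h : ∀ i, w ^ v i = x ^ v i) : w = x := by
  have h1 : (orderOf (w / x) : ℤ) ∣ Finset.univ.gcd v := by
    refine Finset.dvd_gcd fun i _ => ?_
    rw [orderOf_dvd_iff_zpow_eq_one, div_zpow, h i, div_self']
  rw [hgcd] at h1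
  have h2 : orderOf (w / x) = 1 := by
    exact_mod_cast Int.eq_one_of_dvd_one (by positivity) h1
  exact div_eq_one.mp (orderOf_eq_one_iff.mp h2)

end Exponents

/-! ### The curve of elementary symmetric functions -/

section Curve

variable {K : Type*} [Field K]

/-- The Laurent polynomial obtained from the first elementary symmetric polynomial. -/
noncomputable def eOne (K : Type*) [Field K] (v : Fin 3 → ℤ) : K[T;T⁻¹] :=
  T (v 0) + T (v 1) + T (v 2)

/-- The Laurent polynomial obtained from the second elementary symmetric polynomial; the
exponents are `v 1 + v 2 = -v 0` and so on. -/
noncomputable def eTwo (K : Type*) [Field K] (v : Fin 3 → ℤ) : K[T;T⁻¹] :=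
  T (-v 0) + T (-v 1) + T (-v 2)

variable {v : Fin 3 → ℤ}

theorem prod_T_eq_one (hsum : v 0 + v 1 + v 2 = 0) :
    (T (v 0) * T (v 1) * T (v 2) : K[T;T⁻¹]) = 1 := by
  rw [← T_add, ← T_add, hsum, T_zero]

theorem T_neg_eq (hsum : v 0 + v 1 + v 2 = 0) :
    (T (-v 0) : K[T;T⁻¹]) = T (v 1) * T (v 2) ∧ (T (-v 1) : K[T;T⁻¹]) = T (v 0) * T (v 2) ∧
      (T (-v 2) : K[T;T⁻¹]) = T (v 0) * T (v 1) := by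
  refine ⟨?_, ?_, ?_⟩ <;> rw [← T_add] <;> congr 1 <;> omega

/-- The monomials `z ^ v i` are the roots of a cubic with coefficients `eOne`, `eTwo`, `1`. -/
theorem cubic_eq_prod (hsum : v 0 + v 1 + v 2 = 0) (t : K[T;T⁻¹]) :
    t ^ 3 - eOne K v * t ^ 2 + eTwo K v * t - 1
      = (t - T (v 0)) * (t - T (v 1)) * (t - T (v 2)) := by
  obtain ⟨h0, h1, h2⟩ := T_neg_eq (K := K) hsum
  rw [eOne, eTwo, h0, h1, h2]
  linear_combination (-1 : K[T;T⁻¹]) * (-prod_T_eq_one (K := K) hsum)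

theorem exists_zpow_eq_of_ev_eq (hsum : v 0 + v 1 + v 2 = 0) {x w : Kˣ}
    (h1 : ev w (eOne K v) = ev x (eOne K v)) (h2 : ev w (eTwo K v) = ev x (eTwo K v)) (i : Fin 3) :
    ∃ j, w ^ v i = x ^ v j := by
  have hw := congrArg (ev w) (cubic_eq_prod (K := K) hsum (T (v i)))
  have hw0 : ev w ((T (v i) - T (v 0)) * (T (v i) - T (v 1)) * (T (v i) - T (v 2))) = 0 := by
    fin_cases i <;> simp
  rw [hw0] at hw
  have hx := congrArg (ev x) (cubic_eq_prod (K := K) hsum (C ((w ^ v i : Kˣ) : K)))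
  simp only [map_sub, map_add, map_mul, map_pow, h1, h2, map_one, eval₂_T, eval₂_C,
    RingHom.id_apply] at hw hx
  rw [hw] at hx
  have hx' := hx.symm
  simp only [mul_eq_zero, sub_eq_zero, Units.val_inj] at hx'
  rcases hx' with (h | h) | h
  · exact ⟨0, h⟩
  · exact ⟨1, h⟩
  · exact ⟨2, h⟩

/-- The map `z ↦ (eOne v, eTwo v)` is injective at points that are not roots of unity. -/
theorem eq_of_ev_eq (hsum : v 0 + v 1 + v 2 = 0) (hprod : v 0 * v 1 * v 2 ≠ 0)
    (hgcd : Finset.univ.gcd v = 1) {x w : Kˣ} (hx : ¬ IsOfFinOrder x)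
    (h1 : ev w (eOne K v) = ev x (eOne K v)) (h2 : ev w (eTwo K v) = ev x (eTwo K v)) :
    w = x := by
  choose σ hσ using exists_zpow_eq_of_ev_eq hsum h1 h2
  refine eq_of_forall_zpow_eq hgcd fun i => ?_
  rw [hσ, comp_eq_of_mul_comm hsum hprod σ fun i j => ?_]
  refine injective_zpow_iff_not_isOfFinOrder.mpr hx ?_
  dsimp only
  rw [zpow_mul, ← hσ, zpow_mul, ← hσ, ← zpow_mul, ← zpow_mul, mul_comm]

/-- The point `1` is the only point in its fibre under `z ↦ (eOne v, eTwo v)`. -/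
theorem eq_one_of_ev_eq (hsum : v 0 + v 1 + v 2 = 0)
    (hgcd : Finset.univ.gcd v = 1) {w : Kˣ}
    (h1 : ev w (eOne K v) = ev 1 (eOne K v)) (h2 : ev w (eTwo K v) = ev 1 (eTwo K v)) :
    w = 1 := by
  refine eq_of_forall_zpow_eq hgcd fun i => ?_
  obtain ⟨j, hj⟩ := exists_zpow_eq_of_ev_eq hsum h1 h2 i
  rw [hj, one_zpow, one_zpow]

theorem mul_ev_derivative_T (x : Kˣ) (n : ℤ) :
    (x : K) * ev x (derivative (T n)) = n * ((x ^ n : Kˣ) : K) := by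
  have : x ^ n = x * x ^ (n - 1) := by rw [← zpow_one_add]; congr 1; ring
  rw [this, derivative_T]
  simp
  ring

/-- The map `z ↦ (eOne v, eTwo v)` is an immersion at points that are not roots of unity:
otherwise a Vandermonde argument shows that the three numbers `x ^ v i`, whose product is `1`,
coincide. -/
theorem ev_derivative_ne_zero [CharZero K] (hsum : v 0 + v 1 + v 2 = 0)
    (hprod : v 0 * v 1 * v 2 ≠ 0) {x : Kˣ} (hx : ¬ IsOfFinOrder x)
    (h1 : ev x (derivative (eOne K v)) = 0) (h2 : ev x (derivative (eTwo K v)) = 0) : False := by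
  have hne : (v 0 : K) ≠ 0 ∧ (v 1 : K) ≠ 0 ∧ (v 2 : K) ≠ 0 := by
    simp only [Int.cast_ne_zero]
    refine ⟨?_, ?_, ?_⟩ <;> (intro h; simp [h] at hprod)
  obtain ⟨hv0, hv1, hv2⟩ := hne
  have hv : (v 0 : K) + v 1 + v 2 = 0 := by exact_mod_cast hsum
  have hp : x ^ v 0 * x ^ v 1 * x ^ v 2 = 1 := by rw [← zpow_add, ← zpow_add, hsum, zpow_zero]
  have e1 := congrArg ((x : K) * ·) h1
  have e2 := congrArg ((x : K) * ·) h2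
  simp only [eOne, eTwo, derivative_add, map_add, mul_add, mul_ev_derivative_T, mul_zero,
    Int.cast_neg, zpow_neg] at e1 e2
  have key : ∀ X Y Z : Kˣ, (v 0 : K) * X + v 1 * Y + v 2 * Z = 0 →
      -(v 0 : K) * (X⁻¹ : Kˣ) + -v 1 * (Y⁻¹ : Kˣ) + -v 2 * (Z⁻¹ : Kˣ) = 0 → X = Y ∧ X = Z := by
    intro X Y Z h h'
    have hX := X.ne_zero; have hY := Y.ne_zero; have hZ := Z.ne_zero
    have a1 : (v 0 : K) * (X - Z) + v 1 * (Y - Z) = 0 := by linear_combination h - Z * hv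
    have a2 : (v 0 : K) * (X - Z) * Y + v 1 * (Y - Z) * X = 0 := by
      simp only [Units.val_inv_eq_inv_val] at h'
      field_simp at h'
      linear_combination h' + X * Y * hv
    have a3 : (v 1 : K) * (Y - Z) * (X - Y) = 0 := by linear_combination a2 - Y * a1
    have b1 : (Y : K) = Z → (X : K) = Z := by
      intro hYZ
      rw [hYZ, sub_self, mul_zero, add_zero] at a1
      exact sub_eq_zero.mp ((mul_eq_zero.mp a1).resolve_left hv0)
    rcases mul_eq_zero.mp a3 with a4 | a4
    · have hYZ := sub_eq_zero.mp ((mul_eq_zero.mp a4).resolve_left hv1)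
      exact ⟨Units.ext ((b1 hYZ).trans hYZ.symm), Units.ext (b1 hYZ)⟩
    · have hXY := sub_eq_zero.mp a4
      have a5 : (v 2 : K) * (X - Z) = 0 := by
        linear_combination (-1 : K) * a1 - (v 1 : K) * hXY + (X - Z) * hv
      exact ⟨Units.ext hXY, Units.ext (sub_eq_zero.mp ((mul_eq_zero.mp a5).resolve_left hv2))⟩
  obtain ⟨k1, k2⟩ := key _ _ _ e1 e2
  rw [← k1, ← k2, ← zpow_add, ← zpow_add] at hp
  refine hx (isOfFinOrder_iff_zpow_eq_one.mpr ⟨_, ?_, hp⟩)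
  intro h
  apply hv0
  have : v 0 = 0 := by omega
  simp [this]

/-- `z ^ n - 1` is `z - 1` times a Laurent polynomial with value `n` at `1`. -/
theorem exists_T_sub_one_eq (n : ℤ) :
    ∃ h : K[T;T⁻¹], (T n : K[T;T⁻¹]) = 1 + (T 1 - 1) * h ∧ ev 1 h = n := by
  have h0 : ev (1 : Kˣ) (T n - 1 : K[T;T⁻¹]) = 0 := by simp
  obtain ⟨h, hh⟩ := (ev_eq_zero_iff_dvd _ _).mp h0
  rw [Units.val_one, map_one] at hh
  refine ⟨h, by rw [← hh]; ring, ?_⟩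
  have hd := congrArg (fun F => ev (1 : Kˣ) (derivative F)) hh
  have h1 : derivative (1 : K[T;T⁻¹]) = 0 := by simpa using derivative_C (1 : K)
  simpa [derivative_sub, derivative_mul, derivative_T, h1] using hd.symm

/-- At `z = 1` the curve `(eOne v, eTwo v)` has a cusp: one combination of the two coordinates has
a zero of exact order three there. -/
theorem exists_sub_eq_cube [CharZero K] (hsum : v 0 + v 1 + v 2 = 0)
    (hprod : v 0 * v 1 * v 2 ≠ 0) :
    ∃ r : K[T;T⁻¹], eTwo K v - eOne K v = (T 1 - 1) ^ 3 * r ∧ ev 1 r ≠ 0 := by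
  obtain ⟨h0, e0, n0⟩ := exists_T_sub_one_eq (K := K) (v 0)
  obtain ⟨h1, e1, n1⟩ := exists_T_sub_one_eq (K := K) (v 1)
  obtain ⟨h2, e2, n2⟩ := exists_T_sub_one_eq (K := K) (v 2)
  refine ⟨-(h0 * h1 * h2), ?_, ?_⟩
  · have hf : eTwo K v - eOne K v = (1 - T (v 0)) * (1 - T (v 1)) * (1 - T (v 2)) := by
      rw [← cubic_eq_prod hsum]; ring
    rw [hf, e0, e1, e2]; ring
  · rw [map_neg, map_mul, map_mul, n0, n1, n2, neg_ne_zero]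
    exact_mod_cast hprod

/-- At `z = 1` a combination of the coordinates `eOne v`, `eTwo v` has a zero of exact order two. -/
theorem exists_add_eq_sq [CharZero K] (hprod : v 0 * v 1 * v 2 ≠ 0) :
    ∃ k : K[T;T⁻¹], eOne K v + eTwo K v - 6 = (T 1 - 1) ^ 2 * k ∧ ev 1 k ≠ 0 := by
  obtain ⟨h0, e0, n0⟩ := exists_T_sub_one_eq (K := K) (v 0)
  obtain ⟨h1, e1, n1⟩ := exists_T_sub_one_eq (K := K) (v 1)
  obtain ⟨h2, e2, n2⟩ := exists_T_sub_one_eq (K := K) (v 2)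
  have inv : ∀ (n : ℤ) (h : K[T;T⁻¹]), (T n : K[T;T⁻¹]) = 1 + (T 1 - 1) * h →
      (T n + T (-n) - 2 : K[T;T⁻¹]) = (T 1 - 1) ^ 2 * (h ^ 2 * T (-n)) := by
    intro n h hn
    have hT : (T n * T (-n) : K[T;T⁻¹]) = 1 := by rw [← T_add]; simp
    have : (T 1 - 1) * h = (T n - 1 : K[T;T⁻¹]) := by rw [hn]; ring
    calc (T n + T (-n) - 2 : K[T;T⁻¹]) = (T n - 1) ^ 2 * T (-n) := by
          linear_combination (2 - T n) * hT
      _ = _ := by rw [← this]; ring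
  refine ⟨h0 ^ 2 * T (-v 0) + h1 ^ 2 * T (-v 1) + h2 ^ 2 * T (-v 2), ?_, ?_⟩
  · rw [mul_add, mul_add, ← inv _ _ e0, ← inv _ _ e1, ← inv _ _ e2, eOne, eTwo]
    ring
  · have hpos : v 0 ^ 2 + v 1 ^ 2 + v 2 ^ 2 ≠ 0 := by
      have : v 0 ≠ 0 := by intro h; simp [h] at hprod
      positivity
    simp only [map_add, map_mul, map_pow, n0, n1, n2, eval₂_T, one_zpow, Units.val_one, mul_one]
    exact_mod_cast hpos

end Curve

/-! ### The subalgebra generated by the elementary symmetric functions -/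

section Subalgebra

variable {K : Type*} [Field K] {v : Fin 3 → ℤ}

/-- The subalgebra of Laurent polynomials generated by the two elementary symmetric
functions of the monomials `z ^ v i` (the third one being `1`). -/
noncomputable def symmSubalgebra (K : Type*) [Field K] (v : Fin 3 → ℤ) : Subalgebra K K[T;T⁻¹] :=
  Algebra.adjoin K {eOne K v, eTwo K v}

theorem eOne_mem : eOne K v ∈ symmSubalgebra K v := Algebra.subset_adjoin (by simp)

theorem eTwo_mem : eTwo K v ∈ symmSubalgebra K v := Algebra.subset_adjoin (by simp)

theorem C_mem (c : K) : C c ∈ symmSubalgebra K v := by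
  rw [C_eq_algebraMap]
  exact Subalgebra.algebraMap_mem _ c

/-- The derivative at `1` of every member of the subalgebra vanishes, as `∑ v i = 0`. -/
theorem ev_one_derivative_of_mem (hsum : v 0 + v 1 + v 2 = 0) {F : K[T;T⁻¹]}
    (hF : F ∈ symmSubalgebra K v) : ev 1 (derivative F) = 0 := by
  have hv : (v 0 : K) + v 1 + v 2 = 0 := by exact_mod_cast congrArg (Int.cast (R := K)) hsum
  induction hF using Algebra.adjoin_induction with
  | mem x hx =>
    rcases hx with rfl | rfl
    · simpa [eOne, derivative_add, derivative_T] using hv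
    · simp only [eTwo, derivative_add, derivative_T, map_add, map_mul, eval₂_C, eval₂_T,
        RingHom.id_apply, one_zpow, Units.val_one, Int.cast_neg]
      linear_combination -hv
  | algebraMap r => rw [← C_eq_algebraMap, derivative_C, map_zero]
  | add x y _ _ hx hy => rw [derivative_add, map_add, hx, hy, add_zero]
  | mul x y _ _ hx hy => rw [derivative_mul, map_add, map_mul, map_mul, hx, hy]; ring

instance : Algebra.FiniteType K K[T;T⁻¹] := by
  unfold LaurentPolynomial
  infer_instance

theorem isIntegral_T_of_index (hsum : v 0 + v 1 + v 2 = 0) (i : Fin 3) :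
    IsIntegral (symmSubalgebra K v) (T (v i) : K[T;T⁻¹]) := by
  let e₁ : symmSubalgebra K v := ⟨eOne K v, eOne_mem⟩
  let e₂ : symmSubalgebra K v := ⟨eTwo K v, eTwo_mem⟩
  refine ⟨Polynomial.X ^ 3 - (Polynomial.C e₁ * Polynomial.X ^ 2 - Polynomial.C e₂ * Polynomial.X
    + 1), ?_, ?_⟩
  · refine Polynomial.monic_X_pow_sub ?_
    compute_degree!
  · have h := cubic_eq_prod (K := K) hsum (T (v i))
    have h0 : ((T (v i) - T (v 0)) * (T (v i) - T (v 1)) * (T (v i) - T (v 2)) : K[T;T⁻¹]) = 0 := by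
      fin_cases i <;> simp
    rw [h0] at h
    simp only [Polynomial.eval₂_sub, Polynomial.eval₂_add, Polynomial.eval₂_mul,
      Polynomial.eval₂_pow, Polynomial.eval₂_X, Polynomial.eval₂_C, Polynomial.eval₂_one]
    change T (v i) ^ 3 - (eOne K v * T (v i) ^ 2 - eTwo K v * T (v i) + 1) = 0
    rw [← h]; ring

/-- The exponents are nonzero with sum zero, so positive and negative ones occur, which
makes both `z` and `z⁻¹` integral over the subalgebra. -/
theorem isIntegral_T (hsum : v 0 + v 1 + v 2 = 0) (hprod : v 0 * v 1 * v 2 ≠ 0) (n : ℤ) :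
    IsIntegral (symmSubalgebra K v) (T n : K[T;T⁻¹]) := by
  have hv : v 0 ≠ 0 := by intro h; simp [h] at hprod
  obtain ⟨i, hi⟩ : ∃ i, 0 < v i := by
    by_contra! h
    have := h 0; have := h 1; have := h 2
    omega
  obtain ⟨j, hj⟩ : ∃ j, v j < 0 := by
    by_contra! h
    have := h 0; have := h 1; have := h 2
    omega
  have h1 : IsIntegral (symmSubalgebra K v) (T 1 : K[T;T⁻¹]) := by
    refine IsIntegral.of_pow (n := (v i).toNat) (by omega) ?_
    rw [T_pow, mul_one, Int.toNat_of_nonneg hi.le]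
    exact isIntegral_T_of_index hsum i
  have h2 : IsIntegral (symmSubalgebra K v) (T (-1) : K[T;T⁻¹]) := by
    refine IsIntegral.of_pow (n := (-v j).toNat) (by omega) ?_
    rw [T_pow, Int.toNat_of_nonneg (by omega), show -v j * -1 = v j by ring]
    exact isIntegral_T_of_index hsum j
  rcases Int.eq_nat_or_neg n with ⟨m, rfl | rfl⟩
  · simpa [T_pow] using h1.pow m
  · simpa [T_pow] using h2.pow m

theorem finite_symmSubalgebra (hsum : v 0 + v 1 + v 2 = 0) (hprod : v 0 * v 1 * v 2 ≠ 0) :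
    Module.Finite (symmSubalgebra K v) K[T;T⁻¹] := by
  have : Algebra.IsIntegral (symmSubalgebra K v) K[T;T⁻¹] := by
    refine ⟨fun F => ?_⟩
    induction F using LaurentPolynomial.induction_on' with
    | add p q hp hq => exact hp.add hq
    | C_mul_T n a =>
      refine IsIntegral.mul ?_ (isIntegral_T hsum hprod n)
      exact isIntegral_algebraMap (x := (⟨C a, C_mem a⟩ : symmSubalgebra K v))
  have : Algebra.FiniteType (symmSubalgebra K v) K[T;T⁻¹] :=
    Algebra.FiniteType.of_restrictScalars_finiteType K _ _
  exact Algebra.IsIntegral.finite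

theorem isNoetherian_symmSubalgebra (hsum : v 0 + v 1 + v 2 = 0) (hprod : v 0 * v 1 * v 2 ≠ 0) :
    IsNoetherian (symmSubalgebra K v) K[T;T⁻¹] := by
  have := finite_symmSubalgebra (K := K) hsum hprod
  have : Algebra.FiniteType K (symmSubalgebra K v) :=
    (symmSubalgebra K v).fg_iff_finiteType.mp
      (Subalgebra.fg_def.mpr ⟨_, Set.toFinite _, rfl⟩)
  have : IsNoetherianRing (symmSubalgebra K v) := Algebra.FiniteType.isNoetherianRing K _
  exact isNoetherian_of_isNoetherianRing_of_finite _ _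

/-- The subalgebra as a submodule of the ring of Laurent polynomials over itself. -/
noncomputable abbrev baseSubmodule (K : Type*) [Field K] (v : Fin 3 → ℤ) :
    Submodule (symmSubalgebra K v) K[T;T⁻¹] :=
  LinearMap.range (Algebra.linearMap (symmSubalgebra K v) K[T;T⁻¹])

theorem mem_baseSubmodule {F : K[T;T⁻¹]} : F ∈ baseSubmodule K v ↔ F ∈ symmSubalgebra K v := by
  constructor
  · rintro ⟨a, rfl⟩
    exact a.2
  · intro h
    exact ⟨⟨F, h⟩, rfl⟩

/-! ### Local structure of the subalgebra -/

/-- Nakayama's lemma for the subalgebra, at the maximal ideal of a point `x`: if every member of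
`N` is a member of the subalgebra plus a combination, with coefficients in `N`, of two fixed
elements of the subalgebra vanishing at `x`, then an element of the subalgebra with value `1` at `x` multiplies `N` into the
subalgebra. -/
theorem exists_mul_mem (hsum : v 0 + v 1 + v 2 = 0) (hprod : v 0 * v 1 * v 2 ≠ 0) (x : Kˣ)
    {p q : K[T;T⁻¹]} (hp : p ∈ symmSubalgebra K v) (hq : q ∈ symmSubalgebra K v)
    (hp0 : ev x p = 0) (hq0 : ev x q = 0) (N : Submodule (symmSubalgebra K v) K[T;T⁻¹])
    (hN : ∀ F ∈ N, ∃ a ∈ symmSubalgebra K v, ∃ b ∈ N, ∃ c ∈ N, F = a + p * b + q * c) :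
    ∃ s ∈ symmSubalgebra K v, ev x s = 1 ∧ ∀ F ∈ N, s * F ∈ symmSubalgebra K v := by
  have := isNoetherian_symmSubalgebra (K := K) hsum hprod
  let I : Ideal (symmSubalgebra K v) := Ideal.span {⟨p, hp⟩, ⟨q, hq⟩}
  obtain ⟨s, hs, hsN⟩ := exists_smul_mem_of_le_sup_smul I N (baseSubmodule K v)
    (IsNoetherian.noetherian N) (by
      intro F hF
      obtain ⟨a, ha, b, hb, c, hc, rfl⟩ := hN F hF
      rw [add_assoc]
      refine Submodule.add_mem_sup (mem_baseSubmodule.mpr ha) (add_mem ?_ ?_)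
      · exact Submodule.smul_mem_smul (r := (⟨p, hp⟩ : symmSubalgebra K v))
          (Ideal.subset_span (by simp)) hb
      · exact Submodule.smul_mem_smul (r := (⟨q, hq⟩ : symmSubalgebra K v))
          (Ideal.subset_span (by simp)) hc)
  refine ⟨s, s.2, ?_, fun F hF => mem_baseSubmodule.mp (hsN F hF)⟩
  obtain ⟨a, b, hab⟩ := Ideal.mem_span_pair.mp hs
  have h1 := congrArg (fun y : symmSubalgebra K v => ev x (y : K[T;T⁻¹])) hab
  simp only [Subalgebra.coe_add, Subalgebra.coe_mul, Subalgebra.coe_sub, Subalgebra.coe_one,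
    map_add, map_mul, map_sub, map_one, hp0, hq0, mul_zero, add_zero] at h1
  exact (sub_eq_zero.mp h1.symm)

/-- At a point that is not a root of unity, the subalgebra is locally the whole ring of Laurent
polynomials. -/
theorem exists_mul_mem_of_not_isOfFinOrder [CharZero K] [IsAlgClosed K]
    (hsum : v 0 + v 1 + v 2 = 0) (hprod : v 0 * v 1 * v 2 ≠ 0) (hgcd : Finset.univ.gcd v = 1)
    {x : Kˣ} (hx : ¬ IsOfFinOrder x) :
    ∃ s ∈ symmSubalgebra K v, ev x s = 1 ∧ ∀ F, s * F ∈ symmSubalgebra K v := by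
  let p : K[T;T⁻¹] := eOne K v - C (ev x (eOne K v))
  let q : K[T;T⁻¹] := eTwo K v - C (ev x (eTwo K v))
  have hp0 : ev x p = 0 := by simp [p]
  have hq0 : ev x q = 0 := by simp [q]
  have hpJ : p ∈ Ideal.span {p, q} := Ideal.subset_span (by simp)
  have hqJ : q ∈ Ideal.span {p, q} := Ideal.subset_span (by simp)
  have huniq : ∀ w : Kˣ, (∀ F ∈ Ideal.span {p, q}, ev w F = 0) → w = x := by
    intro w hw
    refine eq_of_ev_eq hsum hprod hgcd hx ?_ ?_
    · have := hw p hpJ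
      rwa [map_sub, eval₂_C, sub_eq_zero] at this
    · have := hw q hqJ
      rwa [map_sub, eval₂_C, sub_eq_zero] at this
  have hmem : T 1 - C (x : K) ∈ Ideal.span {p, q} := by
    by_cases h1 : (T 1 - C (x : K)) ^ 2 ∣ p
    · have h2 : ¬ (T 1 - C (x : K)) ^ 2 ∣ q := by
        intro h2
        have d1 := ev_derivative_of_sq_dvd x h1
        have d2 := ev_derivative_of_sq_dvd x h2
        rw [derivative_sub, derivative_C, sub_zero] at d1 d2
        exact ev_derivative_ne_zero hsum hprod hx d1 d2
      simpa using pow_mem_of_unique_zero x huniq (k := 1) hqJ h2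
    · simpa using pow_mem_of_unique_zero x huniq (k := 1) hpJ h1
  obtain ⟨s, hs, hsx, hsF⟩ := exists_mul_mem hsum hprod x
    (sub_mem eOne_mem (C_mem _)) (sub_mem eTwo_mem (C_mem _)) hp0 hq0 ⊤ (by
      intro F _
      have hF : T 1 - C (x : K) ∣ F - C (ev x F) := by
        rw [← ev_eq_zero_iff_dvd]
        simp
      obtain ⟨b, c, hbc⟩ := Ideal.mem_span_pair.mp (Ideal.mem_of_dvd _ hF hmem)
      exact ⟨C (ev x F), C_mem _, b, trivial, c, trivial, by linear_combination -hbc⟩)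
  exact ⟨s, hs, hsx, fun F => hsF F trivial⟩

/-- The Laurent polynomials with vanishing derivative at `1`, as a module over the subalgebra. -/
noncomputable def cuspSubmodule (K : Type*) [Field K] (v : Fin 3 → ℤ)
    (hsum : v 0 + v 1 + v 2 = 0) : Submodule (symmSubalgebra K v) K[T;T⁻¹] where
  carrier := {F | ev 1 (derivative F) = 0}
  add_mem' {F G} hF hG := by
    simp only [Set.mem_ofPred_eq] at hF hG ⊢
    rw [derivative_add, map_add, hF, hG, add_zero]
  zero_mem' := by simpa using congrArg (ev (1 : Kˣ)) (derivative_C (0 : K))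
  smul_mem' a F hF := by
    simp only [Set.mem_ofPred_eq] at hF ⊢
    rw [Subalgebra.smul_def, smul_eq_mul, derivative_mul, map_add, map_mul, map_mul, hF,
      ev_one_derivative_of_mem hsum a.2]
    ring

theorem mem_cuspSubmodule (hsum : v 0 + v 1 + v 2 = 0) {F : K[T;T⁻¹]} :
    F ∈ cuspSubmodule K v hsum ↔ ev 1 (derivative F) = 0 := Iff.rfl

theorem ev_one_derivative_of_dvd {F : K[T;T⁻¹]} (h : (T 1 - 1) ^ 2 ∣ F) :
    ev 1 (derivative F) = 0 := ev_derivative_of_sq_dvd 1 (by simpa using h)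

theorem exists_eq_add_mul {k : K[T;T⁻¹]} (hk : ev 1 k ≠ 0) (G : K[T;T⁻¹]) :
    ∃ (c : K) (H : K[T;T⁻¹]), G = C c * k + (T 1 - 1) * H := by
  have h : ev (1 : Kˣ) (G - C (ev 1 G / ev 1 k) * k) = 0 := by simp [hk]
  obtain ⟨H, hH⟩ := (ev_eq_zero_iff_dvd _ _).mp h
  rw [Units.val_one, map_one] at hH
  exact ⟨_, H, by rw [← hH]; ring⟩

/-- At the point `1`, the subalgebra is locally the ring of Laurent polynomials with vanishing
derivative at `1`: with coordinates having zeros of exact orders two and three, every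
Laurent polynomial vanishing to order two is congruent to a combination of them modulo order four.
-/
theorem exists_mul_mem_one [CharZero K] [IsAlgClosed K]
    (hsum : v 0 + v 1 + v 2 = 0) (hprod : v 0 * v 1 * v 2 ≠ 0) (hgcd : Finset.univ.gcd v = 1) :
    ∃ s ∈ symmSubalgebra K v, ev 1 s = 1 ∧
      ∀ F, ev 1 (derivative F) = 0 → s * F ∈ symmSubalgebra K v := by
  obtain ⟨k, hk, hk1⟩ := exists_add_eq_sq (K := K) hprod
  obtain ⟨r, hr, hr1⟩ := exists_sub_eq_cube (K := K) hsum hprod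
  have hpA : (T 1 - 1) ^ 2 * k ∈ symmSubalgebra K v := by
    rw [← hk]
    exact sub_mem (add_mem eOne_mem eTwo_mem) (ofNat_mem _ 6)
  have hqA : (T 1 - 1) ^ 3 * r ∈ symmSubalgebra K v := by
    rw [← hr]
    exact sub_mem eTwo_mem eOne_mem
  set u : K[T;T⁻¹] := T 1 - 1 with hu
  have hu0 : ev (1 : Kˣ) u = 0 := by simp [hu]
  have hp0 : ev (1 : Kˣ) (u ^ 2 * k) = 0 := by simp [hu0]
  have hq0 : ev (1 : Kˣ) (u ^ 3 * r) = 0 := by simp [hu0]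
  have hpJ : u ^ 2 * k ∈ Ideal.span {u ^ 2 * k, u ^ 3 * r} := Ideal.subset_span (by simp)
  have hqJ : u ^ 3 * r ∈ Ideal.span {u ^ 2 * k, u ^ 3 * r} := Ideal.subset_span (by simp)
  have huniq : ∀ w : Kˣ, (∀ F ∈ Ideal.span {u ^ 2 * k, u ^ 3 * r}, ev w F = 0) → w = 1 := by
    intro w hw
    have a1 := hw _ hpJ
    have a2 := hw _ hqJ
    rw [← hk] at a1
    rw [← hr] at a2
    have b1 := hp0
    have b2 := hq0
    rw [← hk] at b1
    rw [← hr] at b2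
    simp only [map_add, map_sub, map_ofNat] at a1 a2 b1 b2
    have h2 : (2 : K) ≠ 0 := two_ne_zero
    exact eq_one_of_ev_eq hsum hgcd
      (mul_left_cancel₀ h2 (by linear_combination a1 - a2 - b1 + b2))
      (mul_left_cancel₀ h2 (by linear_combination a1 + a2 - b1 - b2))
  have hmem : u ^ 2 ∈ Ideal.span {u ^ 2 * k, u ^ 3 * r} := by
    have := pow_mem_of_unique_zero (1 : Kˣ) huniq (k := 2) hpJ (by
      rw [Units.val_one, map_one, ← hu, pow_succ]
      intro h
      have hdvd := (mul_dvd_mul_iff_left (pow_ne_zero 2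
        (by simpa [hu] using T_one_sub_C_ne_zero (1 : K)))).mp h
      exact hk1 ((ev_eq_zero_iff_dvd 1 k).mpr (by simpa [hu] using hdvd)))
    simpa [hu] using this
  obtain ⟨b, c, hbc⟩ := Ideal.mem_span_pair.mp hmem
  have hsq : ∀ G, u ^ 2 * G ∈ cuspSubmodule K v hsum := fun G =>
    ev_one_derivative_of_dvd (Dvd.intro _ rfl)
  obtain ⟨s, hs, hs1, hsF⟩ := exists_mul_mem hsum hprod 1 hpA hqA hp0 hq0
    (cuspSubmodule K v hsum) (by
      intro F hF
      rw [mem_cuspSubmodule] at hF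
      have h2 : (T 1 - C ((1 : Kˣ) : K)) ^ 2 ∣ F - C (ev 1 F) :=
        sq_dvd_of_ev_derivative 1 (by simp) (by rw [derivative_sub, derivative_C, sub_zero, hF])
      rw [Units.val_one, map_one, ← hu] at h2
      obtain ⟨G, hG⟩ := h2
      obtain ⟨α, H, rfl⟩ := exists_eq_add_mul hk1 G
      obtain ⟨β, H', rfl⟩ := exists_eq_add_mul hr1 H
      rw [← hu] at hG
      refine ⟨C (ev 1 F) + C α * (u ^ 2 * k) + C β * (u ^ 3 * r),
        add_mem (add_mem (C_mem _) (mul_mem (C_mem _) hpA)) (mul_mem (C_mem _) hqA),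
        u ^ 2 * (b * H'), hsq _, u ^ 2 * (c * H'), hsq _, ?_⟩
      linear_combination hG - u ^ 2 * H' * hbc)
  exact ⟨s, hs, hs1, hsF⟩

end Subalgebra

/-! ### The conductor -/

section Conductor

variable {K : Type*} [Field K] [CharZero K] [IsAlgClosed K] {v : Fin 3 → ℤ}

/-- Over an algebraically closed field, a Laurent polynomial with vanishing derivative at `1` lies
in the subalgebra as soon as it vanishes to suitable orders at certain roots of unity other
than `1`. These are the common zeros of the elements that multiply all Laurent polynomials with
vanishing derivative at `1` into the subalgebra. -/
theorem exists_forall_dvd_imp_mem (hsum : v 0 + v 1 + v 2 = 0) (hprod : v 0 * v 1 * v 2 ≠ 0)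
    (hgcd : Finset.univ.gcd v = 1) :
    ∃ (S : Finset Kˣ) (a : Kˣ → ℕ), (∀ w ∈ S, IsOfFinOrder w ∧ w ≠ 1) ∧
      ∀ F : K[T;T⁻¹], ev 1 (derivative F) = 0 →
        (∀ w ∈ S, (T 1 - C (w : K)) ^ a w ∣ F) → F ∈ symmSubalgebra K v := by
  let I : Set K[T;T⁻¹] :=
    {s | s ∈ symmSubalgebra K v ∧ ∀ F, ev 1 (derivative F) = 0 → s * F ∈ symmSubalgebra K v}
  obtain ⟨s₁, hs₁, hs₁1, hs₁F⟩ := exists_mul_mem_one (K := K) hsum hprod hgcd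
  have hs₁I : s₁ ∈ I := ⟨hs₁, hs₁F⟩
  have hne : Ideal.span I ≠ ⊥ := by
    intro h
    have h0 : s₁ = 0 := by
      rw [← Ideal.mem_bot, ← h]
      exact Ideal.subset_span hs₁I
    simp [h0] at hs₁1
  obtain ⟨S, a, ha, hS⟩ := exists_eq_span_prod hne
  have hzero : ∀ w ∈ S, ∀ s ∈ I, ev w s = 0 := by
    intro w hw s hs
    rw [ev_eq_zero_iff_dvd]
    have h1 : (T 1 - C (w : K) : K[T;T⁻¹]) ∣ (T 1 - C (w : K)) ^ a w :=
      dvd_pow_self _ (ha w hw).ne'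
    have h2 := Finset.dvd_prod_of_mem (fun w : Kˣ => (T 1 - C (w : K) : K[T;T⁻¹]) ^ a w) hw
    exact (h1.trans h2).trans (Ideal.mem_span_singleton.mp (hS ▸ Ideal.subset_span hs))
  have hone : ∀ w ∈ S, w ≠ 1 := by
    rintro w hw rfl
    rw [hzero 1 hw s₁ hs₁I] at hs₁1
    exact zero_ne_one hs₁1
  have hord : ∀ w ∈ S, IsOfFinOrder w := by
    intro w hw
    by_contra hinf
    obtain ⟨s, hs, hsw, hsF⟩ := exists_mul_mem_of_not_isOfFinOrder hsum hprod hgcd hinf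
    rw [hzero w hw s ⟨hs, fun F _ => hsF F⟩] at hsw
    exact zero_ne_one hsw
  -- multiples of a member of the ideal by `(z - 1) ^ 2` lie in the subalgebra
  have hmul : ∀ s ∈ Ideal.span I, ∀ b, s * ((T 1 - 1) ^ 2 * b) ∈ symmSubalgebra K v := by
    intro s hs
    induction hs using Submodule.span_induction with
    | mem s hs => exact fun b => hs.2 _ (ev_one_derivative_of_dvd (Dvd.intro _ rfl))
    | zero => exact fun b => by rw [zero_mul]; exact zero_mem _
    | add x y _ _ hx hy => exact fun b => by rw [add_mul]; exact add_mem (hx b) (hy b)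
    | smul c x _ hx =>
      intro b
      convert hx (c * b) using 1
      rw [smul_eq_mul]; ring
  refine ⟨S, a, fun w hw => ⟨hord w hw, hone w hw⟩, fun F hF hdvd => ?_⟩
  have hD : ∏ w ∈ S, (T 1 - C (w : K)) ^ a w ∣ F := by
    refine Finset.prod_dvd_of_coprime (fun w _ w' _ hww' => ?_) hdvd
    exact (isCoprime_T_one_sub_C fun h => hww' (Units.ext h)).pow
  -- subtracting a multiple of `s₁` produces a zero of order two at `1`
  let G : K[T;T⁻¹] := F - C (ev 1 F) * s₁
  have hGD : ∏ w ∈ S, (T 1 - C (w : K)) ^ a w ∣ G :=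
    dvd_sub hD (Dvd.dvd.mul_left
      (Ideal.mem_span_singleton.mp (hS ▸ Ideal.subset_span hs₁I)) _)
  have hG2 : (T 1 - 1) ^ 2 ∣ G := by
    have := sq_dvd_of_ev_derivative (1 : Kˣ) (F := G) (by simp [G, hs₁1]) (by
      rw [derivative_sub, derivative_mul, derivative_C, map_sub, hF, map_add, map_mul, map_mul,
        ev_one_derivative_of_mem hsum hs₁]
      simp)
    simpa using this
  have hcop : IsCoprime (∏ w ∈ S, (T 1 - C (w : K) : K[T;T⁻¹]) ^ a w) ((T 1 - 1) ^ 2) := by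
    refine IsCoprime.prod_left fun w hw => IsCoprime.pow ?_
    have := isCoprime_T_one_sub_C (K := K) (w := w) (w' := 1)
      fun h => hone w hw (Units.ext h)
    simpa using this
  obtain ⟨b, hb⟩ := hcop.mul_dvd hGD hG2
  have hGA : G ∈ symmSubalgebra K v := by
    rw [hb, mul_assoc]
    refine hmul _ ?_ b
    rw [hS]
    exact Ideal.mem_span_singleton_self _
  have : F = G + C (ev 1 F) * s₁ := by simp [G]
  rw [this]
  exact add_mem hGA (mul_mem (C_mem _) hs₁)

end Conductor

/-! ### Descent to the base field and symmetric polynomials -/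

section Descent

variable {k K : Type*} [Field k] [Field K] [Algebra k K] {v : Fin 3 → ℤ}

theorem mapRingHom_T (n : ℤ) :
    AddMonoidAlgebra.mapRingHom ℤ (algebraMap k K) (T n : k[T;T⁻¹]) = (T n : K[T;T⁻¹]) := by
  rw [T, AddMonoidAlgebra.mapRingHom_single, map_one, T]

theorem mapRingHom_C_mul_T (c : k) (n : ℤ) :
    AddMonoidAlgebra.mapRingHom ℤ (algebraMap k K) (C c * T n : k[T;T⁻¹])
      = (C (algebraMap k K c) * T n : K[T;T⁻¹]) := by
  rw [← single_eq_C_mul_T, AddMonoidAlgebra.mapRingHom_single, single_eq_C_mul_T]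

theorem ev_one_derivative_mapRingHom (F : k[T;T⁻¹]) :
    ev 1 (derivative (AddMonoidAlgebra.mapRingHom ℤ (algebraMap k K) F : K[T;T⁻¹]))
      = algebraMap k K (ev 1 (derivative F)) := by
  induction F using LaurentPolynomial.induction_on' with
  | add p q hp hq => rw [map_add, derivative_add, map_add, hp, hq, derivative_add, map_add, map_add]
  | C_mul_T n a => rw [mapRingHom_C_mul_T, derivative_C_mul_T, derivative_C_mul_T]; simp

/-- A Laurent polynomial over `k` that lies in the subalgebra over an extension field `K` lies in
the subalgebra over `k`: apply a `k`-linear retraction `K → k` to the coefficients. -/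
theorem mem_symmSubalgebra_of_mapRingHom_mem {F : k[T;T⁻¹]}
    (hF : (AddMonoidAlgebra.mapRingHom ℤ (algebraMap k K) F : K[T;T⁻¹]) ∈ symmSubalgebra K v) :
    F ∈ symmSubalgebra k v := by
  obtain ⟨π, hπ⟩ := (Algebra.linearMap k K).exists_leftInverse_of_injective
    (LinearMap.ker_eq_bot.mpr (algebraMap k K).injective)
  have hπ1 : ∀ c : k, π (algebraMap k K c) = c := fun c => LinearMap.congr_fun hπ c
  have hπmul : ∀ (c : K) (H : k[T;T⁻¹]), AddMonoidAlgebra.map π.toAddMonoidHom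
      (c • (AddMonoidAlgebra.mapRingHom ℤ (algebraMap k K) H : K[T;T⁻¹])) = C (π c) * H := by
    intro c H
    rw [← smul_eq_C_mul]
    ext n
    have : c * algebraMap k K (H.coeff n) = H.coeff n • c := by rw [Algebra.smul_def, mul_comm]
    simp [this, mul_comm]
  have hπF : AddMonoidAlgebra.map π.toAddMonoidHom
      (AddMonoidAlgebra.mapRingHom ℤ (algebraMap k K) F : K[T;T⁻¹]) = F := by
    have h1 : π 1 = 1 := by simpa using hπ1 1
    simpa [h1] using hπmul 1 F
  have hmono : ∀ G ∈ Submonoid.closure {eOne K v, eTwo K v}, ∃ H ∈ symmSubalgebra k v,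
      G = AddMonoidAlgebra.mapRingHom ℤ (algebraMap k K) H := by
    intro G hG
    induction hG using Submonoid.closure_induction with
    | mem x hx =>
      rcases hx with rfl | rfl
      · exact ⟨eOne k v, eOne_mem, by simp only [eOne, map_add, mapRingHom_T]⟩
      · exact ⟨eTwo k v, eTwo_mem, by simp only [eTwo, map_add, mapRingHom_T]⟩
    | one => exact ⟨1, one_mem _, by rw [map_one]⟩
    | mul x y _ _ hx hy =>
      obtain ⟨H, hH, rfl⟩ := hx
      obtain ⟨H', hH', rfl⟩ := hy
      exact ⟨H * H', mul_mem hH hH', by rw [map_mul]⟩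
  have hall : ∀ G ∈ symmSubalgebra K v,
      AddMonoidAlgebra.map π.toAddMonoidHom G ∈ symmSubalgebra k v := by
    intro G hG
    have hG' : G ∈ Submodule.span K (Submonoid.closure {eOne K v, eTwo K v} : Set K[T;T⁻¹]) := by
      rw [← Algebra.adjoin_eq_span]
      exact hG
    clear hG
    induction hG' using Submodule.closure_induction with
    | zero => rw [AddMonoidAlgebra.map_zero]; exact zero_mem _
    | add x y _ _ hx hy => rw [AddMonoidAlgebra.map_add]; exact add_mem hx hy
    | smul_mem c x hx =>
      obtain ⟨H, hH, rfl⟩ := hmono x hx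
      rw [hπmul]
      exact mul_mem (C_mem _) hH
  rw [← hπF]
  exact hall _ hF

theorem exists_isSymmetric_of_mem (hsum : v 0 + v 1 + v 2 = 0) {F : ℚ[T;T⁻¹]}
    (hF : F ∈ symmSubalgebra ℚ v) :
    ∃ P : MvPolynomial (Fin 3) ℚ, P.IsSymmetric ∧ F = subst v P := by
  induction hF using Algebra.adjoin_induction with
  | mem x hx =>
    rcases hx with rfl | rfl
    · refine ⟨MvPolynomial.psum (Fin 3) ℚ 1, MvPolynomial.psum_isSymmetric _ _ _, ?_⟩
      simp only [subst, MvPolynomial.psum, Fin.sum_univ_three, pow_one, map_add,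
        MvPolynomial.aeval_X, eOne]
    · refine ⟨MvPolynomial.esymm (Fin 3) ℚ 2, MvPolynomial.esymm_isSymmetric _ _ _, ?_⟩
      have h : Finset.powersetCard 2 (Finset.univ : Finset (Fin 3)) = {{0, 1}, {0, 2}, {1, 2}} := by
        decide
      obtain ⟨h0, h1, h2⟩ := T_neg_eq (K := ℚ) hsum
      rw [subst, MvPolynomial.esymm, h, Finset.sum_insert (by decide),
        Finset.sum_insert (by decide), Finset.sum_singleton, eTwo, h0, h1, h2]
      rw [Finset.prod_pair (by decide), Finset.prod_pair (by decide), Finset.prod_pair (by decide)]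
      simp only [map_add, map_mul, MvPolynomial.aeval_X]
      ring
  | algebraMap r =>
    exact ⟨MvPolynomial.C r, MvPolynomial.IsSymmetric.C r, by
      rw [subst, MvPolynomial.aeval_C]⟩
  | add x y _ _ hx hy =>
    obtain ⟨P, hP, rfl⟩ := hx
    obtain ⟨Q, hQ, rfl⟩ := hy
    exact ⟨P + Q, hP.add hQ, by simp only [subst, map_add]⟩
  | mul x y _ _ hx hy =>
    obtain ⟨P, hP, rfl⟩ := hx
    obtain ⟨Q, hQ, rfl⟩ := hy
    exact ⟨P * Q, hP.mul hQ, by simp only [subst, map_mul]⟩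

end Descent

end LaurentSubst

theorem mainTheorem2 (v : Fin 3 → ℤ) (hsum : v 0 + v 1 + v 2 = 0)
    (hprod : v 0 * v 1 * v 2 ≠ 0) (hgcd : Finset.univ.gcd v = 1) :
    ∃ (r : ℕ) (ζ : Fin r → ℂ) (a : Fin r → ℕ),
      (∀ i, (∃ n : ℕ, 0 < n ∧ ζ i ^ n = 1) ∧ ζ i ≠ 1) ∧
      ∀ F : LaurentPolynomial ℚ,
        LaurentSubst.evalAt 1 (LaurentSubst.derivative F) = 0 →
        (∀ i, LaurentSubst.VanishesToOrder F (ζ i) (a i)) →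
        ∃ P : MvPolynomial (Fin 3) ℚ, P.IsSymmetric ∧ F = LaurentSubst.subst v P := by
  obtain ⟨S, a, hS, hmem⟩ := LaurentSubst.exists_forall_dvd_imp_mem (K := ℂ) hsum hprod hgcd
  refine ⟨S.card, fun i => ((S.equivFin.symm i : ℂˣ) : ℂ), fun i => a (S.equivFin.symm i),
    fun i => ?_, fun F hF hv => ?_⟩
  · obtain ⟨hfin, hone⟩ := hS _ (S.equivFin.symm i).2
    obtain ⟨n, hn, hpow⟩ := isOfFinOrder_iff_pow_eq_one.mp hfin
    exact ⟨⟨n, hn, by simpa using congrArg Units.val hpow⟩,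
      fun h => hone (Units.ext h)⟩
  · refine LaurentSubst.exists_isSymmetric_of_mem hsum
      (LaurentSubst.mem_symmSubalgebra_of_mapRingHom_mem (K := ℂ) (hmem _ ?_ fun w hw => ?_))
    · rw [LaurentSubst.ev_one_derivative_mapRingHom]
      exact (congrArg (algebraMap ℚ ℂ) hF).trans (map_zero _)
    · simpa [LaurentSubst.VanishesToOrder] using hv (S.equivFin ⟨w, hw⟩)
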